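/- Let $S$ be a quasi-compact and quasi-separated scheme, and let $\mathrm{Sm}_S^{\mathrm{aff}}$ be the category of smooth, finitely presented $S$-schemes whose underlying scheme is affine, with all $S$-morphisms. Let $t_{\mathrm{AffNis}}$ be the coarsest Grothendieck topology on $\mathrm{Sm}_S^{\mathrm{aff}}$ such that the empty sieve covers the empty scheme $\emptyset$ and such that, for every square in $\mathrm{Sm}_S^{\mathrm{aff}}$ isomorphic to a Cartesian square of the form $$\begin{array}{ccc}\operatorname{Spec}(B_f)&\to&\operatorname{Spec}(B)\\ \downarrow&&\downarrow{\scriptstyle\pi}\\ \operatorname{Spec}(A_f)&\to&\operatorname{Spec}(A)\end{array}$$ where $f\in A$ and $\pi$ is étale and induces an isomorphism $A/fA\cong B/fB$, the sieve on $\operatorname{Spec}(A)$ generated by $\operatorname{Spec}(A_f)\to\operatorname{Spec}(A)$ and $\pi$ is a covering sieve. Let the Nisnevich topology on $\mathrm{Sm}_S^{\mathrm{aff}}$ be the Grothendieck topology generated by the finite families of étale morphisms $\{U_i\to X\}_{i}$ in $\mathrm{Sm}_S^{\mathrm{aff}}$ for which $p\colon\coprod_i U_i\to X$ admits a splitting sequence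 by finitely presented closed subschemes, that is, for which there is a finite chain of closed subschemes $\emptyset=Z_n\subset Z_{n-1}\subset\dots\subset Z_0=X$, each finitely presented over $X$, such that for every $0\le k<n$ the base change of $p$ to $Z_k\setminus Z_{k+1}$ has a section. Then $t_{\mathrm{AffNis}}$ coincides with the Nisnevich topology on $\mathrm{Sm}_S^{\mathrm{aff}}$. -/

import Mathlib

open CategoryTheory Limits AlgebraicGeometry

universe v u

noncomputable section

/-! ### cd-structures and the topologies they generate -/

/-- A cd-structure on a category: a collection of commutative squares closed under isomorphism.
In a square, `X₁` is the top left, `X₂` the top right, `X₃` the bottom left and `X₄` the bottom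
right corner. -/
structure CDStructure (C : Type u) [Category.{v} C] where
  /-- The distinguished squares. -/
  squares : ObjectProperty (Square C)
  isoClosed : squares.IsClosedUnderIsomorphisms

/-- The Grothendieck topology generated by a cd-structure: the coarsest topology (i.e. the one with
the fewest covering sieves) for which the empty sieve covers every initial object, and for
which the two arrows of every distinguished square into its bottom right corner generate
a covering sieve. -/
def CDStructure.topology {C : Type u} [Category.{v} C] (P : CDStructure C) :
    GrothendieckTopology C :=
  sInf {J | (∀ X : C, Nonempty (IsInitial X) → (⊥ : Sieve X) ∈ J X) ∧
    ∀ Q : Square C, P.squares Q → Sieve.ofTwoArrows Q.f₃₄ Q.f₂₄ ∈ J Q.X₄}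

/-! ### Smooth affine schemes -/

/-- The objects of the category of smooth affine `S`-schemes: `S`-schemes that are smooth
and of finite presentation over `S` (a smooth morphism is locally of finite presentation)
and whose underlying scheme is affine. -/
def isSmoothAffine (S : Scheme.{u}) : ObjectProperty (Over S) := fun X =>
  Smooth X.hom ∧ QuasiCompact X.hom ∧ QuasiSeparated X.hom ∧ IsAffine X.left

/-- The category of smooth affine `S`-schemes, with all `S`-morphisms. -/
abbrev SmAff (S : Scheme.{u}) : Type (u + 1) := (isSmoothAffine S).FullSubcategory

/-- The underlying scheme of a smooth affine `S`-scheme. -/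
abbrev SmAff.toScheme (S : Scheme.{u}) : SmAff S ⥤ Scheme.{u} :=
  (isSmoothAffine S).ι ⋙ Over.forget S

/-! ### The affine Nisnevich cd-structure -/

/-- The square with corners `Spec B_f`, `Spec B`, `Spec A_f`, `Spec A` attached to a
ring homomorphism `φ : A → B` and an element `f : A`. -/
def specLocalizationSquare {A B : CommRingCat.{u}} (φ : A ⟶ B) (f : A) : Square Scheme.{u} where
  X₁ := Spec (.of (Localization.Away (φ.hom f)))
  X₂ := Spec B
  X₃ := Spec (.of (Localization.Away f))
  X₄ := Spec A
  f₁₂ := Spec.map (CommRingCat.ofHom (algebraMap B (Localization.Away (φ.hom f))))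
  f₁₃ := Spec.map (CommRingCat.ofHom (Localization.awayMap φ.hom f))
  f₂₄ := Spec.map φ
  f₃₄ := Spec.map (CommRingCat.ofHom (algebraMap A (Localization.Away f)))
  fac := by
    rw [← Spec.map_comp, ← Spec.map_comp]
    congr 1
    ext a
    simp [Localization.awayMap, IsLocalization.Away.map]

/-- The morphism `φ : A → B` induces an isomorphism `A / f ≅ B / f`. -/
def IsIsoModulo {A B : CommRingCat.{u}} (φ : A ⟶ B) (f : A) : Prop :=
  Function.Bijective
    (Ideal.quotientMap ((Ideal.span {f}).map φ.hom) φ.hom Ideal.le_comap_map :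
      A ⧸ Ideal.span {f} →+* B ⧸ (Ideal.span {f}).map φ.hom)

/-- The affine Nisnevich cd-structure on smooth affine `S`-schemes: up to isomorphism its squares
are the squares with corners `Spec B_f`, `Spec B`, `Spec A_f`, `Spec A`, where
`f : A`, `Spec B ⟶ Spec A` is étale, and `A / f ≅ B / f`. (These are automatically Cartesian.
The structure morphisms to `S` are those of the given square in `SmAff S`.) -/
def affineNisnevichCD (S : Scheme.{u}) : CDStructure (SmAff S) where
  squares Q := ∃ (A B : CommRingCat.{u}) (φ : A ⟶ B) (f : A),
    Etale (Spec.map φ) ∧ IsIsoModulo φ f ∧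
      Nonempty (Q.map (SmAff.toScheme S) ≅ specLocalizationSquare φ f)
  isoClosed := ⟨by
    rintro Q Q' e ⟨A, B, φ, f, h₁, h₂, ⟨i⟩⟩
    exact ⟨A, B, φ, f, h₁, h₂, ⟨(SmAff.toScheme S).mapSquare.mapIso e.symm ≪≫ i⟩⟩⟩

/-! ### The Nisnevich topology -/

/-- For closed subschemes `Z = V(I)` and `Z' = V(J)` of `X`, the open subscheme `Z \ Z'` of `Z`. -/
def closedDiff {X : Scheme.{u}} (I J : X.IdealSheafData) : I.subscheme.Opens :=
  I.subschemeι ⁻¹ᵁ J.support.compl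

/-- The locally closed immersion of `Z \ Z'` into `X`, for `Z = V(I)` and `Z' = V(J)`. -/
def closedDiffι {X : Scheme.{u}} (I J : X.IdealSheafData) : (closedDiff I J).toScheme ⟶ X :=
  (closedDiff I J).ι ≫ I.subschemeι

/-- The morphism `p : U ⟶ X` admits a splitting sequence by finitely presented closed subschemes:
a finite chain `∅ = Z n ⊆ ⋯ ⊆ Z 1 ⊆ Z 0 = X` of closed subschemes `Z k = V(I k)`, each finitely
presented over `X`, such that the base change of `p` to `Z k \ Z (k + 1)` has a section
for every `k < n`. -/
def HasSplittingSequence {U X : Scheme.{u}} (p : U ⟶ X) : Prop :=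
  ∃ (n : ℕ) (I : Fin (n + 1) → X.IdealSheafData),
    Monotone I ∧ I 0 = ⊥ ∧ I (Fin.last n) = ⊤ ∧
    (∀ k, LocallyOfFinitePresentation (I k).subschemeι) ∧
    ∀ k : Fin n, IsSplitEpi (pullback.snd p (closedDiffι (I k.castSucc) (I k.succ)))

/-- The generating Nisnevich coverings of smooth affine `S`-schemes: finite families of étale maps
`U i ⟶ X` such that `∐ U i ⟶ X` admits a splitting sequence by finitely presented closed
subschemes. -/
def nisnevichPrecoverage (S : Scheme.{u}) : Precoverage (SmAff S) where
  coverings X := {R | ∃ (m : ℕ) (U : Fin m → SmAff S) (p : ∀ i, U i ⟶ X),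
    (∀ i, Etale ((SmAff.toScheme S).map (p i))) ∧
    HasSplittingSequence (Sigma.desc fun i => (SmAff.toScheme S).map (p i)) ∧
    R = Presieve.ofArrows U p}

/-- The Nisnevich topology on smooth affine `S`-schemes: the Grothendieck topology generated
by the Nisnevich coverings. -/
def nisnevichTopology (S : Scheme.{u}) : GrothendieckTopology (SmAff S) :=
  (nisnevichPrecoverage S).toGrothendieck

end

/-! A distinguished square is a Nisnevich covering for a direct reason: in the chain `Spec A ⊇ V(f)
⊇ ∅`, the map from `Spec A_f` gives a section over the complement of `V(f)`, and the inverse of `A/f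
≅ B/f` gives one over `V(f)`.

For the converse, let `R` be the ring of `X` and `T` the sieve generated by a Nisnevich covering.
Let `P A`, for `A` étale over `R`, say that `T` restricted to `Spec A` covers for the cd-topology.
Everything needed about `P` is contained in `NisnevichLocal`; the rest is algebra. The elements `f`
with `P A_f` form an ideal, `coverIdeal`, because Zariski squares are distinguished. Along a
splitting sequence one shows `I k ≤ coverIdeal` by induction on `k`; at the end `1` lies in it.

The inductive step is `of_etale_section`: if `P B` holds, `I ≤ coverIdeal` is finitely generated,
and `B` has a point in `A/I`, then `P A`. For principal `I`, an idempotent isolates the section and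
yields a distinguished square. For several generators no single square is available. Working
locally, `B` is standard étale and the section is an `a` with `f(a) = ∑ c i * s i`. Subtracting all
but the last term from `f` gives an étale `A`-algebra with a section modulo the last generator
alone, over which the tautological root solves `f` modulo the remaining generators. Induction on the
number of generators finishes (`eval₂_mem_coverIdeal_of_mem_span`). -/

/-! ### Étale-local predicates -/

/-- A predicate on étale ring homomorphisms out of `R` which descends along the squares of the
affine Nisnevich cd-structure. -/
structure NisnevichLocal {R : Type u} [CommRing R]
    (P : ∀ (A : Type u) [CommRing A], (R →+* A) → Prop) : Prop where
  zero : ∀ (A : Type u) [CommRing A] (φ : R →+* A), φ.Etale → Subsingleton A → P A φ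
  mono : ∀ (A B : Type u) [CommRing A] [CommRing B] (φ : R →+* A) (ψ : A →+* B),
    φ.Etale → (ψ.comp φ).Etale → P A φ → P B (ψ.comp φ)
  square : ∀ (A B : Type u) [CommRing A] [CommRing B] (φ : R →+* A) (ψ : A →+* B) (f : A),
    φ.Etale → ψ.Etale →
    Function.Bijective (Ideal.quotientMap ((Ideal.span {f}).map ψ) ψ Ideal.le_comap_map) →
    P (Localization.Away f) ((algebraMap A _).comp φ) → P B (ψ.comp φ) → P A φ

theorem RingHom.Etale.comp {A B C : Type u} [CommRing A] [CommRing B] [CommRing C]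
    {ψ : B →+* C} {φ : A →+* B} (hψ : ψ.Etale) (hφ : φ.Etale) : (ψ.comp φ).Etale :=
  RingHom.Etale.stableUnderComposition _ _ hφ hψ

theorem RingHom.etale_algebraMap_of_etale (A B : Type*) [CommRing A] [CommRing B] [Algebra A B]
    [Algebra.Etale A B] : (algebraMap A B).Etale :=
  RingHom.etale_algebraMap.mpr inferInstance

theorem RingHom.etale_algebraMap_away {A : Type*} [CommRing A] (f : A) :
    (algebraMap A (Localization.Away f)).Etale := by
  have : Algebra.Etale A (Localization.Away f) := .of_isLocalizationAway f
  exact RingHom.etale_algebraMap_of_etale _ _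

namespace NisnevichLocal

variable {R : Type u} [CommRing R] {P : ∀ (A : Type u) [CommRing A], (R →+* A) → Prop}
  (hP : NisnevichLocal P)

include hP in
theorem of_comp_eq {A B : Type u} [CommRing A] [CommRing B] {φ : R →+* A} {χ : R →+* B}
    (ψ : A →+* B) (hφ : φ.Etale) (hχ : χ.Etale) (h : P A φ) (e : ψ.comp φ = χ) : P B χ := by
  subst e
  exact hP.mono A B φ ψ hφ hχ h

include hP in
theorem of_isUnit {A B : Type u} [CommRing A] [CommRing B] {φ : R →+* A} {χ : R →+* B}
    (ψ : A →+* B) (hφ : φ.Etale) (hχ : χ.Etale) {f : A}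
    (h : P (Localization.Away f) ((algebraMap A _).comp φ)) (hf : IsUnit (ψ f))
    (e : ψ.comp φ = χ) : P B χ := by
  refine hP.of_comp_eq (IsLocalization.Away.lift f hf) ((RingHom.etale_algebraMap_away f).comp hφ)
    hχ h ?_
  rw [← RingHom.comp_assoc, IsLocalization.Away.lift_comp, e]

/-- Since `g` is already a unit modulo `f`, inverting it changes nothing modulo `f`. This makes a
Zariski covering by `D(f)` and `D(g)` a distinguished square. -/
theorem bijective_quotientMap_away {A : Type*} [CommRing A] (f g : A)
    (hg : ∃ a b, a * f + b * g = 1) :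
    Function.Bijective (Ideal.quotientMap ((Ideal.span {f}).map
      (algebraMap A (Localization.Away g))) (algebraMap A (Localization.Away g))
      Ideal.le_comap_map) := by
  obtain ⟨a, b, hab⟩ := hg
  have key : ∀ (n : ℕ), ∃ b, b * g ^ n - 1 ∈ Ideal.span {f} := by
    intro n
    refine ⟨b ^ n, ?_⟩
    rw [← Ideal.Quotient.eq_zero_iff_mem, map_sub, map_mul, map_pow, map_pow, map_one,
      ← mul_pow, ← map_mul, show b * g = 1 - a * f by rw [← hab]; ring, map_sub, map_mul,
      Ideal.Quotient.eq_zero_iff_mem.mpr (Ideal.mem_span_singleton_self f)]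
    simp
  constructor
  · rw [injective_iff_map_eq_zero]
    intro x hx
    obtain ⟨x, rfl⟩ := Ideal.Quotient.mk_surjective x
    rw [Ideal.quotientMap_mk, Ideal.Quotient.eq_zero_iff_mem,
      IsLocalization.algebraMap_mem_map_algebraMap_iff (Submonoid.powers g)] at hx
    obtain ⟨_, ⟨n, rfl⟩, hn⟩ := hx
    obtain ⟨b, hb⟩ := key n
    rw [Ideal.Quotient.eq_zero_iff_mem]
    have : x = b * (g ^ n * x) - (b * g ^ n - 1) * x := by ring
    rw [this]
    exact sub_mem (Ideal.mul_mem_left _ _ hn) (Ideal.mul_mem_right _ _ hb)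
  · intro y
    obtain ⟨y, rfl⟩ := Ideal.Quotient.mk_surjective y
    obtain ⟨⟨x, _, n, rfl⟩, hx⟩ := IsLocalization.surj (Submonoid.powers g) y
    obtain ⟨b, hb⟩ := key n
    refine ⟨Ideal.Quotient.mk _ (b * x), ?_⟩
    rw [Ideal.quotientMap_mk, Ideal.Quotient.mk_eq_mk_iff_sub_mem]
    have : algebraMap A (Localization.Away g) (b * x) - y =
        algebraMap A _ (b * g ^ n - 1) * y := by
      simp only [map_mul, map_sub, map_one, ← hx]
      ring
    rw [this]
    exact Ideal.mul_mem_right _ _ (Ideal.mem_map_of_mem _ hb)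

/-- The elements `f` of an étale `R`-algebra `A` such that the predicate `P` holds for `A_f`. -/
def coverIdeal {A : Type u} [CommRing A] (φ : R →+* A) (hφ : φ.Etale) : Ideal A where
  carrier := {f | P (Localization.Away f) ((algebraMap A _).comp φ)}
  zero_mem' := hP.zero _ _ ((RingHom.etale_algebraMap_away _).comp hφ)
    (IsLocalization.subsingleton (M := Submonoid.powers (0 : A)) ⟨1, by simp⟩)
  smul_mem' a f hf := by
    refine hP.of_isUnit (algebraMap A (Localization.Away (a • f))) hφ
      ((RingHom.etale_algebraMap_away _).comp hφ) hf ?_ rfl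
    have := IsLocalization.Away.algebraMap_isUnit (S := Localization.Away (a • f)) (a • f)
    rw [smul_eq_mul, map_mul] at this
    exact isUnit_of_mul_isUnit_right this
  add_mem' {f g} hf hg := by
    let A' := Localization.Away (f + g)
    have hA' : (algebraMap A A').Etale := RingHom.etale_algebraMap_away _
    let f' := algebraMap A A' f
    let g' := algebraMap A A' g
    obtain ⟨u, hu⟩ := (IsLocalization.Away.algebraMap_isUnit (S := A') (f + g)).exists_left_inv
    -- After inverting `f + g`, the elements `f` and `g` generate the unit ideal, so `D(f)` and
    -- `D(g)` form a distinguished square over `A'`.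
    refine hP.square A' (Localization.Away g') _ (algebraMap _ _) f' (hA'.comp hφ)
      (RingHom.etale_algebraMap_away _)
      (bijective_quotientMap_away f' g' ⟨u, u, by rw [← mul_add, ← map_add, hu]⟩) ?_ ?_
    · exact hP.of_isUnit ((algebraMap A' _).comp (algebraMap A A')) hφ
        ((RingHom.etale_algebraMap_away _).comp (hA'.comp hφ)) hf
        (IsLocalization.Away.algebraMap_isUnit f') rfl
    · exact hP.of_isUnit ((algebraMap A' _).comp (algebraMap A A')) hφ
        ((RingHom.etale_algebraMap_away _).comp (hA'.comp hφ)) hg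
        (IsLocalization.Away.algebraMap_isUnit g') rfl

theorem mem_coverIdeal {A : Type u} [CommRing A] {φ : R →+* A} {hφ : φ.Etale} {f : A} :
    f ∈ hP.coverIdeal φ hφ ↔ P (Localization.Away f) ((algebraMap A _).comp φ) := Iff.rfl

theorem mem_coverIdeal_of_hom {A B : Type u} [CommRing A] [CommRing B] {φ : R →+* A}
    {hφ : φ.Etale} {f : A} {χ : R →+* B} (hχ : χ.Etale) (h : P B χ)
    (ψ : B →+* Localization.Away f) (e : ψ.comp χ = (algebraMap A _).comp φ) :
    f ∈ hP.coverIdeal φ hφ :=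
  hP.of_comp_eq ψ hχ ((RingHom.etale_algebraMap_away _).comp hφ) h e

theorem of_mem_coverIdeal {A : Type u} [CommRing A] {φ : R →+* A} {hφ : φ.Etale} {f : A}
    (h : f ∈ hP.coverIdeal φ hφ) (hf : IsUnit f) : P A φ :=
  hP.of_isUnit (RingHom.id A) hφ hφ h hf rfl

theorem of_coverIdeal_eq_top {A : Type u} [CommRing A] {φ : R →+* A} {hφ : φ.Etale}
    (h : hP.coverIdeal φ hφ = ⊤) : P A φ :=
  hP.of_mem_coverIdeal ((Ideal.eq_top_iff_one _).mp h) isUnit_one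

theorem coverIdeal_map_mem {A B : Type u} [CommRing A] [CommRing B] {φ : R →+* A} {hφ : φ.Etale}
    {χ : R →+* B} {hχ : χ.Etale} {f : A} (ψ : A →+* B)
    (h : f ∈ hP.coverIdeal φ hφ) (e : ψ.comp φ = χ) : ψ f ∈ hP.coverIdeal χ hχ := by
  subst e
  exact hP.of_isUnit ((algebraMap B _).comp ψ) hφ ((RingHom.etale_algebraMap_away _).comp hχ) h
    (IsLocalization.Away.algebraMap_isUnit (ψ f)) rfl

end NisnevichLocal
-- Sections of étale algebras and idempotents
open Polynomial (aeval aeval_algebraMap_apply)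

/-- A section makes `A` formally étale over `B`, and for a surjection this means that the kernel is
an idempotent ideal. The kernel is also finitely generated, hence generated by an idempotent. -/
theorem Algebra.exists_isIdempotentElem_ker_eq_span_of_etale {A B : Type*} [CommRing A]
    [CommRing B] [Algebra A B] [Algebra.Etale A B] (σ : B →ₐ[A] A) :
    ∃ e : B, IsIdempotentElem e ∧ RingHom.ker σ = Ideal.span {e} := by
  have hσ : Function.Surjective σ := fun a => ⟨algebraMap A B a, by simp⟩
  let := σ.toAlgebra
  have : IsScalarTower A B A := .of_algebraMap_eq' σ.comp_algebraMap.symm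
  obtain ⟨e, he, hfe⟩ :=
    (Ideal.isIdempotentElem_iff_of_fg _ (Algebra.FinitePresentation.ker_fG_of_surjective σ hσ)).mp
      ((Algebra.FormallyEtale.iff_of_surjective hσ).mp (.of_restrictScalars (R := A)))
  exact ⟨e, he, hfe⟩

/-- An étale algebra with a section over `A / f` contains a principal open which is an étale
neighbourhood of `V(f)`. -/
theorem Algebra.exists_bijective_quotientMap_of_etale {A B : Type*} [CommRing A] [CommRing B]
    [Algebra A B] [Algebra.Etale A B] (I : Ideal A) (σ : B →ₐ[A] A ⧸ I) :
    ∃ e : B, Function.Bijective (Ideal.quotientMap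
      (I.map (algebraMap A (Localization.Away e))) (algebraMap A (Localization.Away e))
      Ideal.le_comap_map) := by
  let A₀ := A ⧸ I
  let ρ : B →ₐ[A] TensorProduct A A₀ B := Algebra.TensorProduct.includeRight
  have hρ : Function.Surjective ρ :=
    Algebra.TensorProduct.includeRight_surjective B Ideal.Quotient.mk_surjective
  have hker : ∀ b, ρ b = 0 → b ∈ I.map (algebraMap A B) := by
    intro b hb
    rw [← Ideal.Quotient.eq_zero_iff_mem]
    apply (Algebra.TensorProduct.quotIdealMapEquivQuotTensor B I).injective
    rw [map_zero]
    exact hb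
  let τ : TensorProduct A A₀ B →ₐ[A₀] A₀ :=
    Algebra.TensorProduct.lift (AlgHom.id A₀ A₀) σ (fun _ _ => mul_comm _ _)
  have hτ : ∀ b, τ (ρ b) = σ b := fun b =>
    (Algebra.TensorProduct.lift_tmul _ _ _ _ _).trans (by simp)
  -- The section is a component of the fibre over `A/I`, cut out by `1 - e₀`; any lift `e` of `1 -
  -- e₀` to `B` removes the other components of that fibre.
  obtain ⟨e₀, he₀, hspan⟩ := exists_isIdempotentElem_ker_eq_span_of_etale τ
  obtain ⟨e, he⟩ := hρ (1 - e₀)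
  have hσe : σ e = 1 := by
    have : e₀ ∈ RingHom.ker τ := hspan ▸ Ideal.mem_span_singleton_self e₀
    rw [← hτ, he, map_sub, map_one, RingHom.mem_ker.mp this, sub_zero]
  have hK : ∀ b, σ b = 0 → e * b ∈ I.map (algebraMap A B) := by
    intro b hb
    apply hker
    have : ρ b ∈ RingHom.ker τ := by rw [RingHom.mem_ker, hτ, hb]
    rw [hspan, Ideal.mem_span_singleton] at this
    obtain ⟨c, hc⟩ := this
    rw [map_mul, he, hc, ← mul_assoc, sub_mul, one_mul, he₀.eq, sub_self, zero_mul]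
  refine ⟨e, ?_, ?_⟩
  · rw [injective_iff_map_eq_zero]
    intro x hx
    obtain ⟨x, rfl⟩ := Ideal.Quotient.mk_surjective x
    rw [Ideal.quotientMap_mk, Ideal.Quotient.eq_zero_iff_mem] at hx
    -- As `σ e = 1`, the section extends to `B_e` and retracts the map in question, which gives
    -- injectivity.
    let σ' : Localization.Away e →+* A ⧸ I :=
      IsLocalization.Away.lift (g := σ.toRingHom) e (by simp [hσe])
    have hσ' : σ'.comp (algebraMap A (Localization.Away e)) = Ideal.Quotient.mk I := by
      rw [IsScalarTower.algebraMap_eq A B, ← RingHom.comp_assoc, IsLocalization.Away.lift_comp]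
      exact σ.comp_algebraMap
    have := Ideal.mem_map_of_mem σ' hx
    rw [Ideal.map_map, hσ', Ideal.map_quotient_self, Ideal.mem_bot,
      ← RingHom.comp_apply, hσ'] at this
    exact this
  · intro y
    obtain ⟨y, rfl⟩ := Ideal.Quotient.mk_surjective y
    obtain ⟨⟨b, _, n, rfl⟩, hb⟩ := IsLocalization.surj (Submonoid.powers e) y
    obtain ⟨a, ha⟩ := Ideal.Quotient.mk_surjective (σ b)
    refine ⟨Ideal.Quotient.mk _ a, ?_⟩
    rw [Ideal.quotientMap_mk, Ideal.Quotient.mk_eq_mk_iff_sub_mem]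
    have hu := IsLocalization.Away.algebraMap_isUnit (S := Localization.Away e) e
    have hmem : ∀ c : B, σ c = 0 →
        algebraMap B (Localization.Away e) c ∈ I.map (algebraMap A (Localization.Away e)) := by
      intro c hc
      rw [← Ideal.unit_mul_mem_iff_mem _ hu, ← map_mul, IsScalarTower.algebraMap_eq A B,
        ← Ideal.map_map]
      exact Ideal.mem_map_of_mem _ (hK c hc)
    rw [← Ideal.unit_mul_mem_iff_mem _ (hu.pow n)]
    have := hmem (e ^ n * algebraMap A B a - b) (by simp [hσe, ← ha])
    rw [map_sub, map_mul, map_pow, ← hb, ← IsScalarTower.algebraMap_apply] at this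
    rw [mul_sub]
    convert this using 2
    simp [mul_comm]

/-! ### Descent along étale algebras with sections over closed subschemes -/

namespace NisnevichLocal

variable {R : Type u} [CommRing R] {P : ∀ (A : Type u) [CommRing A], (R →+* A) → Prop}
  (hP : NisnevichLocal P)

include hP in
/-- Descent along an étale algebra with a section over a principal closed subscheme. -/
theorem of_section_quotient_span_singleton {A B : Type u} [CommRing A] [CommRing B] [Algebra A B]
    [Algebra.Etale A B] {φ : R →+* A} (hφ : φ.Etale) (f : A)
    (σ : B →ₐ[A] A ⧸ Ideal.span {f}) (hf : f ∈ hP.coverIdeal φ hφ)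
    (hB : P B ((algebraMap A B).comp φ)) : P A φ := by
  obtain ⟨e, he⟩ := Algebra.exists_bijective_quotientMap_of_etale _ σ
  have hB' := (RingHom.etale_algebraMap_of_etale A B).comp hφ
  refine hP.square A (Localization.Away e) φ (algebraMap A _) f hφ
    (RingHom.etale_algebraMap_of_etale _ _) he hf ?_
  refine hP.of_comp_eq (algebraMap B _) hB'
    ((RingHom.etale_algebraMap_of_etale _ _).comp hφ) hB ?_
  rw [IsScalarTower.algebraMap_eq A B (Localization.Away e), RingHom.comp_assoc]

/-- Standard étale version: given a root of `f` modulo `s`. -/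
theorem eval_mem_coverIdeal_of_mem_span_singleton {A : Type u} [CommRing A] {φ : R →+* A}
    {hφ : φ.Etale} (Q : StandardEtalePair A) (s a : A) (hs : s ∈ hP.coverIdeal φ hφ)
    (hQ : P Q.Ring ((algebraMap A _).comp φ)) (ha : Q.f.eval a ∈ Ideal.span {s}) :
    Q.g.eval a ∈ hP.coverIdeal φ hφ := by
  -- Once `g(a)` is inverted, the class of `a` modulo `s` is a genuine point of the standard étale
  -- algebra.
  let A' := Localization.Away (Q.g.eval a)
  let Q' := Q.map (algebraMap A A')
  have hA' := (RingHom.etale_algebraMap_away (Q.g.eval a)).comp hφ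
  have hmap : Q'.HasMap
      (Ideal.Quotient.mk (Ideal.span {algebraMap A A' s}) (algebraMap A A' a)) := by
    have heval : ∀ p : Polynomial A,
        aeval (Ideal.Quotient.mk (Ideal.span {algebraMap A A' s}) (algebraMap A A' a))
          (p.map (algebraMap A A')) = Ideal.Quotient.mk _ (algebraMap A A' (p.eval a)) := by
      intro p
      rw [Polynomial.aeval_map_algebraMap, ← Ideal.Quotient.algebraMap_eq,
        ← IsScalarTower.algebraMap_apply, Polynomial.aeval_algebraMap_apply_eq_algebraMap_eval,
        ← IsScalarTower.algebraMap_apply]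
    constructor
    · refine (heval Q.f).trans (Ideal.Quotient.eq_zero_iff_mem.mpr ?_)
      simpa [Ideal.map_span] using Ideal.mem_map_of_mem (algebraMap A A') ha
    · exact (heval Q.g).symm ▸ (IsLocalization.Away.algebraMap_isUnit (S := A') _).map _
  refine hP.of_section_quotient_span_singleton (B := Q'.Ring) hA' (algebraMap A A' s)
    (Q'.lift _ hmap) (hP.coverIdeal_map_mem _ hs rfl) ?_
  let := Algebra.compHom Q'.Ring (algebraMap A A')
  have : IsScalarTower A A' Q'.Ring := .of_algebraMap_eq' rfl
  -- The tautological root of `Q'` is also a point of `Q`; the resulting map `Q.Ring → Q'.Ring`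
  -- transports `P`.
  have hX : Q.HasMap Q'.X := by
    have h := Q'.hasMap_X
    simpa [StandardEtalePair.HasMap, Q'] using h
  refine hP.of_comp_eq (Q.lift _ hX).toRingHom
    ((RingHom.etale_algebraMap_of_etale _ _).comp hφ)
    ((RingHom.etale_algebraMap_of_etale _ _).comp hA') hQ ?_
  rw [← RingHom.comp_assoc, ← RingHom.comp_assoc]
  congr 1
  exact (Q.lift _ hX).comp_algebraMap

include hP in
/-- If `a` is a root of a monic polynomial `f` modulo an ideal generated by finitely many
elements over the complement of whose common zeros `P` holds, and `P` holds for `(R[X]/f)_g`, then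
`P` holds away from `g(a)`. The roots are lifted one generator at a time, by perturbing `f`. -/
theorem eval₂_mem_coverIdeal_of_mem_span (Q : StandardEtalePair R)
    (hdvd : Q.f.derivative ∣ Q.g) (hQ : P Q.Ring (algebraMap _ _)) (m : ℕ) :
    ∀ {A : Type u} [CommRing A] {φ : R →+* A} (hφ : φ.Etale) (s : Fin m → A)
      (_ : ∀ i, s i ∈ hP.coverIdeal φ hφ) (a : A)
      (_ : Q.f.eval₂ φ a ∈ Ideal.span (Set.range s)),
      Q.g.eval₂ φ a ∈ hP.coverIdeal φ hφ := by
  induction m with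
  | zero =>
    intro A _ φ hφ s hs a ha
    let := φ.toAlgebra
    let A' := Localization.Away (Q.g.eval₂ φ a)
    have hmap : Q.HasMap (algebraMap A A' a) := by
      constructor
      · have : Q.f.eval₂ φ a = 0 := by simpa using ha
        rw [aeval_algebraMap_apply, Polynomial.aeval_def, RingHom.algebraMap_toAlgebra, this,
          map_zero]
      · rw [aeval_algebraMap_apply, Polynomial.aeval_def, RingHom.algebraMap_toAlgebra]
        exact IsLocalization.Away.algebraMap_isUnit _
    exact hP.mem_coverIdeal_of_hom (RingHom.etale_algebraMap_of_etale _ _) hQ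
      (Q.lift _ hmap).toRingHom
      ((Q.lift _ hmap).comp_algebraMap.trans (IsScalarTower.algebraMap_eq R A A'))
  | succ m ih =>
    intro A _ φ hφ s hs a ha
    -- In degree zero `f = 1`, and subtracting a constant could destroy monicity; but then the `s i`
    -- already generate the unit ideal.
    by_cases hdeg : Q.f.natDegree = 0
    · rw [Q.monic_f.natDegree_eq_zero.mp hdeg, Polynomial.eval₂_one] at ha
      have : hP.coverIdeal φ hφ = ⊤ := by
        rw [Ideal.eq_top_iff_one]
        exact Ideal.span_le.mpr (Set.range_subset_iff.mpr hs) ha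
      rw [this]
      trivial
    rw [Ideal.mem_span_range_iff_exists_fun] at ha
    obtain ⟨c, hc⟩ := ha
    rw [Fin.sum_univ_castSucc] at hc
    obtain ⟨d, hd⟩ : ∃ d, d = ∑ i : Fin m, c i.castSucc * s i.castSucc := ⟨_, rfl⟩
    rw [← hd] at hc
    -- The perturbation is by a constant, so the derivative of `f` is unchanged and still divides
    -- `g`: this is where `hdvd` keeps the algebra étale.
    let Q₁ : StandardEtalePair A :=
      { f := Q.f.map φ - Polynomial.C d
        monic_f := by
          rcases subsingleton_or_nontrivial A with hA | hA
          · exact Subsingleton.elim _ _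
          · refine (Q.monic_f.map φ).sub_of_left (Polynomial.degree_C_le.trans_lt ?_)
            rw [Q.monic_f.degree_map]
            exact Polynomial.natDegree_pos_iff_degree_pos.mp (Nat.pos_of_ne_zero hdeg)
        g := Q.g.map φ
        cond := by
          obtain ⟨q, hq⟩ := hdvd
          exact ⟨q.map φ, 0, 1, by simp [hq, Polynomial.derivative_map]⟩ }
    have hf : Q₁.f.eval a = c (Fin.last m) * s (Fin.last m) := by
      simp [Q₁, Polynomial.eval_map, ← hc]
    have hg : Q₁.g.eval a = Q.g.eval₂ φ a := by simp [Q₁, Polynomial.eval_map]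
    have hQ₁ := RingHom.etale_algebraMap_of_etale A Q₁.Ring
    rw [← hg]
    refine hP.eval_mem_coverIdeal_of_mem_span_singleton Q₁ (s (Fin.last m)) a (hs _) ?_
      (hf ▸ Ideal.mul_mem_left _ _ (Ideal.mem_span_singleton_self _))
    -- Over `Q₁.Ring` the root satisfies `f(X) = d`, which lies in the span of the first `m`
    -- generators; since `g(X)` is a unit there, the induction hypothesis gives `P Q₁.Ring`.
    have key := ih (hQ₁.comp hφ) (fun i => algebraMap A Q₁.Ring (s i.castSucc))
      (fun i => hP.coverIdeal_map_mem _ (hs _) rfl) Q₁.X ?_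
    · refine hP.of_mem_coverIdeal key ?_
      have := Q₁.hasMap_X.2
      simpa [Q₁, Polynomial.aeval_def, Polynomial.eval₂_map] using this
    · have := Q₁.hasMap_X.1
      rw [map_sub, Polynomial.aeval_C, sub_eq_zero, Polynomial.aeval_def,
        Polynomial.eval₂_map] at this
      rw [this, hd, map_sum]
      refine sum_mem fun i _ => ?_
      rw [map_mul]
      exact Ideal.mul_mem_left _ _ (Ideal.subset_span ⟨i, rfl⟩)

include hP in
-- The ideals `I` and `(a)` both lie in `coverIdeal` and together generate the unit ideal.
theorem of_isUnit_quotient_mk {A : Type u} [CommRing A] {φ : R →+* A} (hφ : φ.Etale)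
    (I : Ideal A) (hI : I ≤ hP.coverIdeal φ hφ) (a : A) (ha : a ∈ hP.coverIdeal φ hφ)
    (hu : IsUnit (Ideal.Quotient.mk I a)) : P A φ := by
  obtain ⟨u, hu⟩ := hu.exists_left_inv
  obtain ⟨u, rfl⟩ := Ideal.Quotient.mk_surjective u
  rw [← map_mul, ← map_one (Ideal.Quotient.mk I), Ideal.Quotient.mk_eq_mk_iff_sub_mem] at hu
  refine hP.of_coverIdeal_eq_top (hφ := hφ) ((Ideal.eq_top_iff_one _).mpr ?_)
  simpa using sub_mem (Ideal.mul_mem_left _ u ha) (hI hu)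

include hP in
theorem of_standardEtalePair_section (Q : StandardEtalePair R) (hQ : P Q.Ring (algebraMap _ _))
    {A : Type u} [CommRing A] {φ : R →+* A} (hφ : φ.Etale) (I : Ideal A) (hI : I.FG)
    (hI' : I ≤ hP.coverIdeal φ hφ) (σ : Q.Ring →+* A ⧸ I)
    (hσ : σ.comp (algebraMap _ _) = (Ideal.Quotient.mk I).comp φ) : P A φ := by
  -- Multiplying `g` by the derivative of `f` arranges the divisibility needed for the perturbation.
  -- No point is lost, since that derivative is already invertible in `Q.Ring`.
  let Q₀ : StandardEtalePair R :=
    { f := Q.f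
      monic_f := Q.monic_f
      g := Q.g * Q.f.derivative
      cond := ⟨Q.g, 0, 1, by ring⟩ }
  have hmap : Q.HasMap Q₀.X := by
    refine ⟨Q₀.hasMap_X.1, ?_⟩
    have := Q₀.hasMap_X.2
    rw [map_mul] at this
    exact isUnit_of_mul_isUnit_left this
  have hQ₀ : P Q₀.Ring (algebraMap _ _) :=
    hP.of_comp_eq (Q.lift _ hmap).toRingHom (RingHom.etale_algebraMap_of_etale _ _)
      (RingHom.etale_algebraMap_of_etale _ _) hQ (Q.lift _ hmap).comp_algebraMap
  obtain ⟨m, s, rfl⟩ := Submodule.fg_iff_exists_fin_generating_family.mp hI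
  obtain ⟨a, ha⟩ := Ideal.Quotient.mk_surjective (σ Q.X)
  have heval : ∀ p : Polynomial R,
      Ideal.Quotient.mk _ (p.eval₂ φ a) = σ (aeval Q.X p) := fun p => by
    rw [Polynomial.hom_eval₂, ha, ← hσ, ← Polynomial.hom_eval₂, Polynomial.aeval_def]
  refine hP.of_isUnit_quotient_mk hφ _ hI' _
    (hP.eval₂_mem_coverIdeal_of_mem_span Q₀ (Dvd.intro_left _ rfl) hQ₀ m hφ s
      (fun i => hI' (Submodule.subset_span ⟨i, rfl⟩)) a ?_) ?_
  · have := heval Q.f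
    rw [Q.hasMap_X.1, map_zero, Ideal.Quotient.eq_zero_iff_mem] at this
    exact this
  · rw [heval, map_mul]
    exact (Q.hasMap_X.2.mul Q.hasMap_X.isUnit_derivative_f).map σ

theorem _root_.Algebra.span_isStandardEtale_away_eq_top (R B : Type*) [CommRing R] [CommRing B]
    [Algebra R B] [Algebra.Etale R B] :
    Ideal.span {b : B | Algebra.IsStandardEtale R (Localization.Away b)} = ⊤ := by
  by_contra h
  obtain ⟨M, hM, hle⟩ := Ideal.exists_le_maximal _ h
  obtain ⟨b, hb, hb'⟩ := Algebra.IsEtaleAt.exists_isStandardEtale (R := R) M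
  exact hb (hle (Ideal.subset_span hb'))

theorem map_le_coverIdeal {A B : Type u} [CommRing A] [CommRing B] {φ : R →+* A} {hφ : φ.Etale}
    {χ : R →+* B} {hχ : χ.Etale} {I : Ideal A} (ψ : A →+* B)
    (h : I ≤ hP.coverIdeal φ hφ) (e : ψ.comp φ = χ) : I.map ψ ≤ hP.coverIdeal χ hχ := by
  rw [Ideal.map_le_iff_le_comap]
  intro x hx
  rw [Ideal.mem_comap]
  exact hP.coverIdeal_map_mem ψ (h hx) e

include hP in
/-- Descent along an étale `R`-algebra with a section over a finitely presented closed
subscheme. -/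
theorem of_etale_section {B : Type u} [CommRing B] [Algebra R B] [Algebra.Etale R B]
    (hB : P B (algebraMap R B))
    {A : Type u} [CommRing A] {φ : R →+* A} (hφ : φ.Etale) (I : Ideal A) (hI : I.FG)
    (hI' : I ≤ hP.coverIdeal φ hφ) (σ : B →+* A ⧸ I)
    (hσ : σ.comp (algebraMap _ _) = (Ideal.Quotient.mk I).comp φ) : P A φ := by
  -- Wherever `B_b` is standard étale, a lift `a` of `σ b` lies in `coverIdeal`, because `σ` extends
  -- to `B_b` after inverting `a`. Such `b` generate the unit ideal.
  have hle : Ideal.span {b : B | Algebra.IsStandardEtale R (Localization.Away b)} ≤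
      ((hP.coverIdeal φ hφ).map (Ideal.Quotient.mk I)).comap σ := by
    rw [Ideal.span_le]
    intro b hb
    have : Algebra.IsStandardEtale R (Localization.Away b) := hb
    obtain ⟨Q⟩ := Algebra.IsStandardEtale.nonempty_standardEtalePresentation (R := R)
      (S := Localization.Away b)
    obtain ⟨a, ha⟩ := Ideal.Quotient.mk_surjective (σ b)
    rw [SetLike.mem_coe, Ideal.mem_comap, ← ha]
    refine Ideal.mem_map_of_mem _ (hP.mem_coverIdeal.mpr ?_)
    let A' := Localization.Away a
    have hA' := (RingHom.etale_algebraMap_away a).comp hφ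
    let I' := I.map (algebraMap A A')
    let ρ : A ⧸ I →+* A' ⧸ I' := Ideal.quotientMap I' (algebraMap A A') Ideal.le_comap_map
    have hu : IsUnit ((ρ.comp σ) b) := by
      rw [RingHom.comp_apply, ← ha, Ideal.quotientMap_mk]
      exact (IsLocalization.Away.algebraMap_isUnit a).map _
    let σ' : Localization.Away b →+* A' ⧸ I' := IsLocalization.Away.lift b hu
    have hσ' : σ'.comp (algebraMap R (Localization.Away b)) =
        (Ideal.Quotient.mk I').comp ((algebraMap A A').comp φ) := by
      rw [IsScalarTower.algebraMap_eq R B, ← RingHom.comp_assoc, IsLocalization.Away.lift_comp,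
        RingHom.comp_assoc, hσ]
      rfl
    refine hP.of_standardEtalePair_section Q.P ?_ hA' I' (hI.map _) ?_
      (σ'.comp Q.equivRing.symm.toAlgHom.toRingHom) ?_
    · refine hP.of_comp_eq (Q.equivRing.toAlgHom.toRingHom.comp
        (algebraMap B (Localization.Away b))) (RingHom.etale_algebraMap_of_etale _ _)
        (RingHom.etale_algebraMap_of_etale _ _) hB ?_
      rw [RingHom.comp_assoc, ← IsScalarTower.algebraMap_eq R B]
      exact Q.equivRing.toAlgHom.comp_algebraMap
    · exact hP.map_le_coverIdeal (algebraMap A A') hI' rfl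
    · rw [RingHom.comp_assoc, ← hσ']
      congr 1
      exact Q.equivRing.symm.toAlgHom.comp_algebraMap
  rw [Algebra.span_isStandardEtale_away_eq_top, top_le_iff, Ideal.comap_eq_top_iff] at hle
  refine hP.of_coverIdeal_eq_top (hφ := hφ) ?_
  -- Pulled back to `A`, this reads `coverIdeal ⊔ I = ⊤`, and `I` is absorbed.
  have := congrArg (Ideal.comap (Ideal.Quotient.mk I)) hle
  rwa [Ideal.comap_map_of_surjective _ Ideal.Quotient.mk_surjective, ← RingHom.ker_eq_comap_bot,
    Ideal.mk_ker, sup_eq_left.mpr hI', Ideal.comap_top] at this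

include hP in
/-- Descent along an étale `R`-algebra with a splitting sequence. -/
theorem of_splittingSequence {B : Type u} [CommRing B] [Algebra R B] [Algebra.Etale R B]
    (hB : P B (algebraMap R B)) (n : ℕ) (I : Fin (n + 1) → Ideal R) (h0 : I 0 = ⊥)
    (hn : I (Fin.last n) = ⊤) (hfg : ∀ k, (I k).FG)
    (H : ∀ k : Fin n, ∀ f ∈ I k.succ,
      ∃ σ : B →+* Localization.Away (Ideal.Quotient.mk (I k.castSucc) f),
        σ.comp (algebraMap R B) =
          (algebraMap (R ⧸ I k.castSucc) _).comp (Ideal.Quotient.mk (I k.castSucc))) :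
    P R (RingHom.id R) := by
  have hid : (RingHom.id R).Etale := .of_bijective Function.bijective_id
  have key : ∀ k, I k ≤ hP.coverIdeal (RingHom.id R) hid := by
    intro k
    induction k using Fin.induction with
    | zero => rw [h0]; exact bot_le
    | succ k ih =>
      -- On `D(f)` with `f ∈ I k.succ`, the part of `Z k` that remains lies off `Z (k + 1)`, so a
      -- section exists there; the complement of `Z k` is handled by `ih`.
      intro f hf
      obtain ⟨σ, hσ⟩ := H k f hf
      let J := I k.castSucc
      let R' := Localization.Away f
      let J' := J.map (algebraMap R R')
      let ρ : R ⧸ J →+* R' ⧸ J' := Ideal.quotientMap J' (algebraMap R R') Ideal.le_comap_map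
      have hu : IsUnit (ρ (Ideal.Quotient.mk J f)) := by
        rw [Ideal.quotientMap_mk]
        exact (IsLocalization.Away.algebraMap_isUnit f).map _
      refine hP.of_etale_section hB ((RingHom.etale_algebraMap_away f).comp hid) J'
        ((hfg _).map _) ?_ ((IsLocalization.Away.lift _ hu).comp σ) ?_
      · exact hP.map_le_coverIdeal (algebraMap R R') ih rfl
      · rw [RingHom.comp_assoc, hσ, ← RingHom.comp_assoc, IsLocalization.Away.lift_comp]
        rfl
  exact hP.of_coverIdeal_eq_top (top_le_iff.mp (hn ▸ key _))

end NisnevichLocal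

/-! ### Covering sieves and étale algebras over a smooth affine scheme -/

namespace CDStructure

variable {C : Type u} [Category.{v} C] (K : CDStructure C)

theorem bot_mem_topology {X : C} (hX : IsInitial X) : (⊥ : Sieve X) ∈ K.topology X :=
  (GrothendieckTopology.mem_sInf _ _).mpr fun _ hJ => hJ.1 X ⟨hX⟩

theorem ofTwoArrows_mem_topology (Q : Square C) (hQ : K.squares Q) :
    Sieve.ofTwoArrows Q.f₃₄ Q.f₂₄ ∈ K.topology Q.X₄ :=
  (GrothendieckTopology.mem_sInf _ _).mpr fun _ hJ => hJ.2 Q hQ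

theorem topology_le (J : GrothendieckTopology C)
    (h₁ : ∀ X : C, IsInitial X → (⊥ : Sieve X) ∈ J X)
    (h₂ : ∀ Q : Square C, K.squares Q → Sieve.ofTwoArrows Q.f₃₄ Q.f₂₄ ∈ J Q.X₄) :
    K.topology ≤ J :=
  sInf_le ⟨fun X ⟨hX⟩ => h₁ X hX, h₂⟩

end CDStructure

namespace SmAff

variable {S : Scheme.{u}} (X : SmAff S)

instance : IsAffine X.obj.left := X.property.2.2.2

/-- The ring of functions on a smooth affine scheme. -/
abbrev ring : CommRingCat.{u} := Γ(X.obj.left, ⊤)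

/-- The morphism `Spec A ⟶ X` given by a ring homomorphism out of the ring of functions. -/
noncomputable def specι {A : Type u} [CommRing A] (φ : X.ring →+* A) :
    Spec (.of A) ⟶ X.obj.left :=
  Spec.map (CommRingCat.ofHom φ) ≫ X.obj.left.isoSpec.inv

theorem specMap_specι {A B : Type u} [CommRing A] [CommRing B] {φ : X.ring →+* A}
    {χ : X.ring →+* B} (ψ : A →+* B) (e : ψ.comp φ = χ) :
    Spec.map (CommRingCat.ofHom ψ) ≫ X.specι φ = X.specι χ := by
  subst e
  rw [specι, specι, CommRingCat.ofHom_comp, Spec.map_comp, Category.assoc]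

theorem etale_specι {A : Type u} [CommRing A] {φ : X.ring →+* A} (hφ : φ.Etale) :
    Etale (X.specι φ) := by
  have : Etale (Spec.map (CommRingCat.ofHom φ)) := HasRingHomProperty.Spec_iff.mpr hφ
  rw [specι]
  infer_instance

/-- The smooth affine scheme `Spec A`, for `A` étale over the ring of functions of `X`. -/
noncomputable def spec {A : Type u} [CommRing A] (φ : X.ring →+* A) (hφ : φ.Etale) : SmAff S where
  obj := Over.mk (X.specι φ ≫ X.obj.hom)
  property := by
    have := X.etale_specι hφ
    have := X.property.1
    have := X.property.2.1
    have := X.property.2.2.1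
    refine ⟨?_, ?_, ?_, ?_⟩
    · dsimp; infer_instance
    · dsimp; infer_instance
    · dsimp; infer_instance
    · dsimp; infer_instance

/-- The structure morphism of the étale `X`-scheme `Spec A`. -/
noncomputable def specHom {A : Type u} [CommRing A] (φ : X.ring →+* A) (hφ : φ.Etale) :
    X.spec φ hφ ⟶ X :=
  ObjectProperty.homMk (Over.homMk (X.specι φ))

/-- The morphism of étale `X`-schemes attached to a homomorphism of étale algebras. -/
noncomputable def specMap {A B : Type u} [CommRing A] [CommRing B] {φ : X.ring →+* A}
    {χ : X.ring →+* B} {hφ : φ.Etale} {hχ : χ.Etale} (ψ : A →+* B) (e : ψ.comp φ = χ) :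
    X.spec χ hχ ⟶ X.spec φ hφ :=
  ObjectProperty.homMk (Over.homMk (Spec.map (CommRingCat.ofHom ψ)) (by
    dsimp [spec]
    rw [← Category.assoc, X.specMap_specι ψ e]))

theorem hom_ext {X Y : SmAff S} {f g : X ⟶ Y} (h : f.hom.left = g.hom.left) : f = g :=
  ObjectProperty.hom_ext _ (Over.OverMorphism.ext h)

theorem specMap_specHom {A B : Type u} [CommRing A] [CommRing B] {φ : X.ring →+* A}
    {χ : X.ring →+* B} {hφ : φ.Etale} {hχ : χ.Etale} (ψ : A →+* B) (e : ψ.comp φ = χ) :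
    X.specMap (hφ := hφ) (hχ := hχ) ψ e ≫ X.specHom φ hφ = X.specHom χ hχ :=
  hom_ext (X.specMap_specι ψ e)

/-- A smooth affine scheme with empty underlying space is initial. -/
noncomputable def isInitialOfIsEmpty [IsEmpty X.obj.left] : IsInitial X :=
  IsInitial.ofUniqueHom
    (fun _ => ObjectProperty.homMk (Over.homMk (AlgebraicGeometry.isInitialOfIsEmpty.to _)
      (AlgebraicGeometry.isInitialOfIsEmpty.hom_ext _ _)))
    (fun _ _ => hom_ext (AlgebraicGeometry.isInitialOfIsEmpty.hom_ext _ _))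

/-- The spectrum of the zero ring is an object of the category, and an initial object maps to it. -/
theorem isEmpty_of_isInitial (hX : IsInitial X) : IsEmpty X.obj.left := by
  have f := hX.to (X.spec _ (RingHom.etale_algebraMap_away (0 : X.ring)))
  have : Subsingleton (Localization.Away (0 : X.ring)) :=
    IsLocalization.subsingleton (M := Submonoid.powers (0 : X.ring)) ⟨1, by simp⟩
  have : IsEmpty (X.spec _ (RingHom.etale_algebraMap_away (0 : X.ring))).obj.left :=
    inferInstanceAs (IsEmpty (PrimeSpectrum (Localization.Away (0 : X.ring))))
  exact Function.isEmpty f.hom.left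

/-- The predicate on étale algebras that the restriction of a sieve is covering. -/
def IsCovering (J : GrothendieckTopology (SmAff S)) (T : Sieve X) (A : Type u) [CommRing A]
    (φ : X.ring →+* A) : Prop :=
  ∀ hφ : φ.Etale, T.pullback (X.specHom φ hφ) ∈ J (X.spec φ hφ)

/-- The three closure properties are the empty covering, stability under pullback, and transitivity
applied to a distinguished square. -/
theorem nisnevichLocal_isCovering (T : Sieve X) :
    NisnevichLocal (X.IsCovering (affineNisnevichCD S).topology T) where
  zero A _ φ hφ hA _ := by
    have : IsEmpty (X.spec φ hφ).obj.left := inferInstanceAs (IsEmpty (PrimeSpectrum A))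
    exact GrothendieckTopology.superset_covering _ bot_le
      ((affineNisnevichCD S).bot_mem_topology (X.spec φ hφ).isInitialOfIsEmpty)
  mono A B _ _ φ ψ hφ hχ h _ := by
    have := GrothendieckTopology.pullback_stable _ (X.specMap (hχ := hχ) ψ rfl) (h hφ)
    rwa [← Sieve.pullback_comp, specMap_specHom] at this
  square A B _ _ φ ψ f hφ hψ hf h₁ h₂ _ := by
    have hχ := hψ.comp hφ
    let Bf := Localization.Away (ψ f)
    let Q : Square (SmAff S) :=
      { X₁ := X.spec ((algebraMap B Bf).comp (ψ.comp φ)) ((RingHom.etale_algebraMap_away _).comp hχ)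
        X₂ := X.spec (ψ.comp φ) hχ
        X₃ := X.spec ((algebraMap A (Localization.Away f)).comp φ)
          ((RingHom.etale_algebraMap_away _).comp hφ)
        X₄ := X.spec φ hφ
        f₁₂ := X.specMap (algebraMap B Bf) rfl
        f₁₃ := X.specMap (Localization.awayMap ψ f) (by
          rw [← RingHom.comp_assoc, ← RingHom.comp_assoc]
          congr 1
          ext a
          simp [Localization.awayMap, IsLocalization.Away.map, Bf])
        f₂₄ := X.specMap ψ rfl
        f₃₄ := X.specMap (algebraMap A _) rfl
        fac := hom_ext (specLocalizationSquare (CommRingCat.ofHom ψ) f).fac }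
    have hQ : (affineNisnevichCD S).squares Q :=
      ⟨.of A, .of B, CommRingCat.ofHom ψ, f, HasRingHomProperty.Spec_iff.mpr hψ, hf,
        ⟨Square.isoMk (Iso.refl _) (Iso.refl _) (Iso.refl _) (Iso.refl _)
          ((Category.comp_id _).trans (Category.id_comp _).symm)
          ((Category.comp_id _).trans (Category.id_comp _).symm)
          ((Category.comp_id _).trans (Category.id_comp _).symm)
          ((Category.comp_id _).trans (Category.id_comp _).symm)⟩⟩
    refine GrothendieckTopology.transitive _
      ((affineNisnevichCD S).ofTwoArrows_mem_topology Q hQ) _ ?_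
    rintro Y _ ⟨Z, g, _, ⟨i⟩, rfl⟩
    rw [Sieve.pullback_comp]
    refine GrothendieckTopology.pullback_stable _ _ ?_
    cases i with
    | left =>
      have := h₁ ((RingHom.etale_algebraMap_away _).comp hφ)
      rwa [← X.specMap_specHom (hφ := hφ) (algebraMap A _) rfl, Sieve.pullback_comp] at this
    | right =>
      have := h₂ hχ
      rwa [← X.specMap_specHom (hφ := hφ) ψ rfl, Sieve.pullback_comp] at this

theorem isoSpec_hom_specι_id :
    X.obj.left.isoSpec.hom ≫ X.specι (RingHom.id X.ring) = 𝟙 _ := by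
  rw [specι, CommRingCat.ofHom_id, Spec.map_id, Category.id_comp, Iso.hom_inv_id]

theorem mem_of_isCovering_id {J : GrothendieckTopology (SmAff S)} {T : Sieve X}
    (h : X.IsCovering J T X.ring (RingHom.id X.ring)) : T ∈ J X := by
  have hid : (RingHom.id X.ring).Etale := .of_bijective Function.bijective_id
  let e : X ⟶ X.spec (RingHom.id X.ring) hid :=
    ObjectProperty.homMk (Over.homMk X.obj.left.isoSpec.hom (by
      dsimp [spec]
      rw [← Category.assoc, isoSpec_hom_specι_id, Category.id_comp]))
  have := J.pullback_stable e (h hid)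
  rwa [← Sieve.pullback_comp,
    show e ≫ X.specHom _ hid = 𝟙 X from hom_ext X.isoSpec_hom_specι_id,
    Sieve.pullback_id] at this

/-- The ring homomorphism attached to a morphism of smooth affine schemes. -/
abbrev ringHom {U X : SmAff S} (p : U ⟶ X) : X.ring →+* U.ring := p.hom.left.appTop.hom

theorem specι_ringHom {U X : SmAff S} (p : U ⟶ X) :
    X.specι (ringHom p) = U.obj.left.isoSpec.inv ≫ p.hom.left :=
  Scheme.isoSpec_inv_naturality p.hom.left

theorem etale_ringHom {U X : SmAff S} (p : U ⟶ X) [Etale p.hom.left] : (ringHom p).Etale :=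
  (HasRingHomProperty.iff_of_isAffine (P := @Etale)).mp inferInstance

/-- A sieve pulled back along one of its own members is maximal. -/
theorem isCovering_ringHom {U X : SmAff S} (J : GrothendieckTopology (SmAff S)) {T : Sieve X}
    (p : U ⟶ X) (hp : T p) : X.IsCovering J T U.ring (ringHom p) := by
  intro hφ
  let e : X.spec (ringHom p) hφ ⟶ U :=
    ObjectProperty.homMk (Over.homMk U.obj.left.isoSpec.inv (by
      dsimp [spec]
      rw [specι_ringHom, Category.assoc, Over.w]))
  have he : X.specHom (ringHom p) hφ = e ≫ p := hom_ext (specι_ringHom p)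
  rw [Sieve.mem_iff_pullback_eq_top _ |>.mp (he ▸ T.downward_closed hp e)]
  exact J.top_mem _

end SmAff

/-! ### Locally closed subschemes -/

namespace AlgebraicGeometry.Scheme

theorem exists_comp_closedDiffι_eq {X T : Scheme.{u}} (I J : X.IdealSheafData) (g : T ⟶ X)
    (hI : I ≤ g.ker) (hJ : ∀ t, g t ∉ J.support) : ∃ d, d ≫ closedDiffι I J = g := by
  let g' := IsClosedImmersion.lift I.subschemeι g (by rwa [IdealSheafData.ker_subschemeι])
  have hg' : g' ≫ I.subschemeι = g := IsClosedImmersion.lift_fac _ _ _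
  refine ⟨IsOpenImmersion.lift (closedDiff I J).ι g' ?_, ?_⟩
  · rintro _ ⟨t, rfl⟩
    rw [Opens.range_ι]
    change (g' ≫ I.subschemeι) t ∉ J.support
    rw [hg']
    exact hJ t
  · exact (IsOpenImmersion.lift_fac_assoc _ _ _ _).trans hg'

theorem closedDiffι_notMem_support {X : Scheme.{u}} (I J : X.IdealSheafData) (x) :
    closedDiffι I J x ∉ J.support := by
  rw [closedDiffι, Scheme.Hom.comp_apply]
  exact x.2

theorem IdealSheafData.fg_ideal_top {X : Scheme.{u}} [IsAffine X] (I : X.IdealSheafData)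
    [LocallyOfFinitePresentation I.subschemeι] : (I.ideal ⟨⊤, isAffineOpen_top X⟩).FG := by
  have : IsAffine I.subscheme := isAffine_of_isAffineHom I.subschemeι
  have hfp : I.subschemeι.appTop.hom.FinitePresentation :=
    (HasRingHomProperty.iff_of_isAffine (P := @LocallyOfFinitePresentation)).mp inferInstance
  rw [← I.ker_subschemeι_app]
  have hs := I.subschemeι_app_surjective ⟨⊤, isAffineOpen_top X⟩
  let := I.subschemeι.appTop.hom.toAlgebra
  have : Algebra.FinitePresentation Γ(X, ⊤) Γ(I.subscheme, ⊤) := hfp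
  exact Algebra.FinitePresentation.ker_fG_of_surjective
    (Algebra.ofId Γ(X, ⊤) Γ(I.subscheme, ⊤)) hs

end AlgebraicGeometry.Scheme

namespace SmAff

variable {S : Scheme.{u}} (X : SmAff S)

/-- The ideal of functions attached to an ideal sheaf. -/
abbrev idealTop (I : X.obj.left.IdealSheafData) : Ideal X.ring :=
  I.ideal ⟨⊤, isAffineOpen_top X.obj.left⟩

theorem isoSpec_inv_appTop :
    X.obj.left.isoSpec.inv.appTop = (Scheme.ΓSpecIso X.ring).inv := by
  have := congrArg Scheme.Hom.appTop X.obj.left.isoSpec.inv_hom_id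
  rw [Scheme.Hom.comp_appTop, Scheme.Hom.id_appTop] at this
  exact (Iso.eq_inv_comp _).mpr ((congrArg (· ≫ _) X.obj.left.toSpecΓ_appTop.symm).trans this)

theorem appTop_specι {A : Type u} [CommRing A] (φ : X.ring →+* A) :
    (X.specι φ).appTop = CommRingCat.ofHom φ ≫ (Scheme.ΓSpecIso (.of A)).inv := by
  rw [specι, Scheme.Hom.comp_appTop, isoSpec_inv_appTop]
  exact (Scheme.ΓSpecIso_inv_naturality _).symm

theorem specι_notMem_support {A : Type u} [CommRing A] (φ : X.ring →+* A)
    (J : X.obj.left.IdealSheafData) (f : X.ring) (hf : f ∈ X.idealTop J) (hu : IsUnit (φ f))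
    (t : Spec (.of A)) : X.specι φ t ∉ J.support := by
  intro ht
  have h := J.supportSet_subset_zeroLocus ⟨⊤, isAffineOpen_top _⟩ ht
  rw [Scheme.mem_zeroLocus_iff] at h
  refine h f hf ?_
  change t ∈ X.specι φ ⁻¹ᵁ (X.obj.left.basicOpen f)
  have hu' : IsUnit ((X.specι φ).appTop f) := by
    rw [appTop_specι]
    exact hu.map (Scheme.ΓSpecIso (.of A)).inv.hom
  rw [Scheme.preimage_basicOpen]
  exact (Scheme.basicOpen_of_isUnit _ hu').symm ▸ trivial

theorem le_ker_specι {A : Type u} [CommRing A] (φ : X.ring →+* A)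
    (I : X.obj.left.IdealSheafData) (h : X.idealTop I ≤ RingHom.ker φ) : I ≤ (X.specι φ).ker := by
  refine Scheme.IdealSheafData.le_of_isAffine ?_
  rw [Scheme.Hom.ker_apply]
  intro x hx
  change (X.specι φ).appTop x = 0
  rw [appTop_specι]
  change (Scheme.ΓSpecIso (.of A)).inv.hom (φ x) = 0
  rw [h hx, map_zero]

theorem exists_specι_factors_closedDiffι (I J : X.obj.left.IdealSheafData) (f : X.ring)
    (hf : f ∈ X.idealTop J) {A : Type u} [CommRing A] (φ : X.ring →+* A)
    (hI : X.idealTop I ≤ RingHom.ker φ) (hu : IsUnit (φ f)) :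
    ∃ d, d ≫ closedDiffι I J = X.specι φ :=
  Scheme.exists_comp_closedDiffι_eq I J _ (X.le_ker_specι φ I hI)
    (X.specι_notMem_support φ J f hf hu)

/-! ### Disjoint unions -/

section Sigma

variable {X} {m : ℕ} {U : Fin m → SmAff S} (p : ∀ i, U i ⟶ X)

/-- The product of the rings of functions of a finite family of smooth affine `X`-schemes, as an
algebra over the ring of functions of `X`. -/
abbrev piRingHom : X.ring →+* (∀ i, (U i).ring) := RingHom.pi fun i => ringHom (p i)

/-- The comparison of a disjoint union of affine schemes with the spectrum of the product. -/
noncomputable def sigmaToSpec (U : Fin m → SmAff S) :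
    (∐ fun i => (U i).obj.left) ⟶ Spec (.of (∀ i, (U i).ring)) :=
  Sigma.desc fun i => (U i).obj.left.isoSpec.hom ≫
    Spec.map (CommRingCat.ofHom (Pi.evalRingHom (fun i => (U i).ring) i))

theorem sigmaToSpec_specι :
    sigmaToSpec U ≫ X.specι (piRingHom p) = Sigma.desc fun i => (p i).hom.left := by
  refine Sigma.hom_ext _ _ fun i => ?_
  rw [sigmaToSpec, Sigma.ι_desc_assoc, Sigma.ι_desc, Category.assoc,
    X.specMap_specι (χ := ringHom (p i)) _ rfl, specι_ringHom, Iso.hom_inv_id_assoc]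

theorem etale_piRingHom [∀ i, Etale (p i).hom.left] : (piRingHom p).Etale := by
  let (i : Fin m) : Algebra X.ring (U i).ring := (ringHom (p i)).toAlgebra
  have (i : Fin m) : Algebra.Etale X.ring (U i).ring := etale_ringHom (p i)
  exact RingHom.etale_algebraMap_of_etale X.ring (∀ i, (U i).ring)

/-- The idempotents of the product lie in `coverIdeal`, because inverting the `i`-th one gives an
algebra over the ring of `U i`, and they sum to `1`. -/
theorem isCovering_piRingHom [∀ i, Etale (p i).hom.left] {T : Sieve X} (hT : ∀ i, T (p i)) :
    X.IsCovering (affineNisnevichCD S).topology T _ (piRingHom p) := by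
  classical
  have hp := etale_piRingHom p
  have hP := X.nisnevichLocal_isCovering T
  refine hP.of_coverIdeal_eq_top (hφ := hp) ((Ideal.eq_top_iff_one _).mpr ?_)
  rw [show (1 : ∀ i, (U i).ring) = ∑ i, Pi.single i 1 from
    (Finset.univ_sum_single (1 : ∀ i, (U i).ring)).symm]
  refine sum_mem fun i _ => ?_
  let e : ∀ i, (U i).ring := Pi.single i 1
  let A := Localization.Away e
  have he : algebraMap _ A e = 1 := by
    refine (IsLocalization.Away.algebraMap_isUnit (S := A) e).mul_left_cancel ?_
    rw [← map_mul, mul_one, ← Pi.single_mul, mul_one]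
  let ψ : (U i).ring →+* A :=
    { toFun b := algebraMap (∀ i, (U i).ring) A (Pi.single i b)
      map_one' := he
      map_mul' a b := by rw [Pi.single_mul, map_mul]
      map_zero' := by rw [Pi.single_zero, map_zero]
      map_add' a b := by rw [Pi.single_add, map_add] }
  refine hP.mem_coverIdeal_of_hom (etale_ringHom (p i))
    (isCovering_ringHom _ (p i) (hT i)) ψ ?_
  ext r
  have : (Pi.single i (ringHom (p i) r) : ∀ i, (U i).ring) = e * piRingHom p r := by
    ext j
    by_cases h : j = i
    · subst h; simp [e]
    · simp [e, h]
  change algebraMap (∀ i, (U i).ring) A (Pi.single i (ringHom (p i) r)) =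
    algebraMap (∀ i, (U i).ring) A (piRingHom p r)
  rw [this, map_mul, he, one_mul]

/-- An étale family with a splitting sequence generates a covering sieve for the topology of the
affine Nisnevich cd-structure. -/
theorem mem_affineNisnevich_of_hasSplittingSequence [∀ i, Etale (p i).hom.left]
    (h : HasSplittingSequence (Sigma.desc fun i => (p i).hom.left)) :
    Sieve.generate (Presieve.ofArrows U p) ∈ (affineNisnevichCD S).topology X := by
  obtain ⟨n, I, -, h0, hn, hfp, hs⟩ := h
  refine X.mem_of_isCovering_id ?_
  have hP := X.nisnevichLocal_isCovering (Sieve.generate (Presieve.ofArrows U p))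
  have hB := isCovering_piRingHom p (T := Sieve.generate (Presieve.ofArrows U p))
    fun i => ⟨_, 𝟙 _, p i, .mk i, Category.id_comp _⟩
  let := (piRingHom p).toAlgebra
  have : Algebra.Etale X.ring (∀ i, (U i).ring) := etale_piRingHom p
  refine hP.of_splittingSequence (B := ∀ i, (U i).ring) hB n (fun k => X.idealTop (I k)) ?_ ?_
    (fun k => (I k).fg_ideal_top) ?_
  · rw [h0]; rfl
  · rw [hn]; rfl
  intro k f hf
  let A := Localization.Away (Ideal.Quotient.mk (X.idealTop (I k.castSucc)) f)
  let φ : X.ring →+* A := (algebraMap (X.ring ⧸ X.idealTop (I k.castSucc)) A).comp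
    (Ideal.Quotient.mk (X.idealTop (I k.castSucc)))
  obtain ⟨d, hd⟩ := X.exists_specι_factors_closedDiffι (I k.castSucc) (I k.succ) f hf φ
    (fun x hx => by
      rw [RingHom.mem_ker, RingHom.comp_apply, Ideal.Quotient.eq_zero_iff_mem.mpr hx, map_zero])
    (IsLocalization.Away.algebraMap_isUnit (Ideal.Quotient.mk (X.idealTop (I k.castSucc)) f))
  have := hs k
  -- The given section, restricted to the affine piece `Z k ∩ D(f)` of `Z k \ Z (k + 1)`, becomes a
  -- ring homomorphism out of the product.
  let θ : Spec (.of A) ⟶ Spec (.of (∀ i, (U i).ring)) :=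
    d ≫ section_ (pullback.snd _ (closedDiffι (I k.castSucc) (I k.succ))) ≫
      pullback.fst (Sigma.desc fun i => (p i).hom.left) _ ≫ sigmaToSpec U
  have hθ : θ ≫ X.specι (piRingHom p) = X.specι φ := by
    simp only [θ, Category.assoc]
    rw [sigmaToSpec_specι, pullback.condition, IsSplitEpi.id_assoc, hd]
  refine ⟨(Spec.preimage θ).hom, ?_⟩
  have h₂ : Spec.map (CommRingCat.ofHom (piRingHom p) ≫ Spec.preimage θ) =
      Spec.map (CommRingCat.ofHom φ) := by
    rw [← cancel_mono X.obj.left.isoSpec.inv, Spec.map_comp, Spec.map_preimage, Category.assoc]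
    exact hθ
  exact congrArg CommRingCat.Hom.hom (Spec.map_injective h₂)

end Sigma

end SmAff

/-! ### Distinguished squares are Nisnevich coverings -/

namespace AlgebraicGeometry.Scheme

theorem isSplitEpi_pullback_snd {U X T : Scheme.{u}} {p : U ⟶ X} {t : T ⟶ X} (s : T ⟶ U)
    (hs : s ≫ p = t) : IsSplitEpi (pullback.snd p t) :=
  .mk' ⟨pullback.lift s (𝟙 T) (by rw [hs, Category.id_comp]), pullback.lift_snd _ _ _⟩

theorem locallyOfFinitePresentation_ker_subschemeι {Z X : Scheme.{u}} (i : Z ⟶ X)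
    [IsClosedImmersion i] [LocallyOfFinitePresentation i] :
    LocallyOfFinitePresentation i.ker.subschemeι := by
  have h : inv i.toImage ≫ i = i.imageι := by rw [IsIso.inv_comp_eq, Hom.toImage_imageι]
  have : LocallyOfFinitePresentation i.imageι := h ▸ inferInstance
  exact this

/-- A splitting sequence of length two, for a morphism with sections over a closed subscheme and
over its open complement. -/
theorem hasSplittingSequence_of_closed_of_open {U X Z V : Scheme.{u}} {p : U ⟶ X} (i : Z ⟶ X)
    (j : V ⟶ X) [IsClosedImmersion i] [LocallyOfFinitePresentation i] [IsOpenImmersion j]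
    (h : (Set.range i)ᶜ ⊆ Set.range j) (z : Z ⟶ U) (hz : z ≫ p = i) (v : V ⟶ U)
    (hv : v ≫ p = j) : HasSplittingSequence p := by
  refine ⟨2, ![⊥, i.ker, ⊤], ?_, rfl, rfl, ?_, ?_⟩
  · refine Fin.monotone_iff_le_succ.mpr fun k => ?_
    fin_cases k
    · exact bot_le
    · exact le_top
  · intro k
    fin_cases k
    · change LocallyOfFinitePresentation (IdealSheafData.subschemeι ⊥)
      infer_instance
    · exact locallyOfFinitePresentation_ker_subschemeι i
    · change LocallyOfFinitePresentation (IdealSheafData.subschemeι ⊤)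
      infer_instance
  · intro k
    fin_cases k
    · change IsSplitEpi (pullback.snd p (closedDiffι ⊥ i.ker))
      have hr : Set.range (closedDiffι ⊥ i.ker) ⊆ Set.range j := by
        rintro _ ⟨x, rfl⟩
        exact h fun hx => closedDiffι_notMem_support _ _ x (i.range_subset_ker_support hx)
      exact isSplitEpi_pullback_snd (IsOpenImmersion.lift j (closedDiffι ⊥ i.ker) hr ≫ v)
        (by rw [Category.assoc, hv, IsOpenImmersion.lift_fac])
    · change IsSplitEpi (pullback.snd p (closedDiffι i.ker ⊤))
      refine isSplitEpi_pullback_snd ((closedDiff i.ker ⊤).ι ≫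
        IsClosedImmersion.lift i i.ker.subschemeι (by rw [IdealSheafData.ker_subschemeι]) ≫ z) ?_
      rw [Category.assoc, Category.assoc, hz, IsClosedImmersion.lift_fac, closedDiffι]

end AlgebraicGeometry.Scheme

/-- Composing `B → B/fB` with the inverse of `A/f ≅ B/fB` gives the section of `Spec B → Spec A`
over `V(f)`. -/
theorem IsIsoModulo.exists_hom {A B : CommRingCat.{u}} {φ : A ⟶ B} {f : A}
    (h : IsIsoModulo φ f) : ∃ τ : B ⟶ .of (A ⧸ Ideal.span {f}),
      φ ≫ τ = CommRingCat.ofHom (Ideal.Quotient.mk (Ideal.span {f})) := by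
  let e := RingEquiv.ofBijective _ h
  refine ⟨CommRingCat.ofHom (e.symm.toRingHom.comp
    (Ideal.Quotient.mk ((Ideal.span {f}).map φ.hom))), ?_⟩
  ext a
  exact (RingEquiv.symm_apply_eq e).mpr rfl

namespace SmAff

variable {S : Scheme.{u}}

/-- A pair of objects as a family. -/
def pairObj (V U : SmAff S) : Fin 2 → SmAff S
  | 0 => V
  | 1 => U

/-- A pair of morphisms as a family. -/
def pairHom {X V U : SmAff S} (j : V ⟶ X) (q : U ⟶ X) : ∀ i, pairObj V U i ⟶ X
  | 0 => j
  | 1 => q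

theorem ofTwoArrows_mem_nisnevichTopology {X V U : SmAff S} (j : V ⟶ X) (q : U ⟶ X)
    [Etale j.hom.left] [Etale q.hom.left]
    (h : HasSplittingSequence (Sigma.desc fun i => (pairHom j q i).hom.left)) :
    Sieve.ofTwoArrows j q ∈ nisnevichTopology S X := by
  have hmem : Presieve.ofArrows (pairObj V U) (pairHom j q) ∈ nisnevichPrecoverage S X := by
    refine ⟨2, _, pairHom j q, fun i => ?_, h, rfl⟩
    fin_cases i
    · exact ‹Etale j.hom.left›
    · exact ‹Etale q.hom.left›
  refine GrothendieckTopology.superset_covering _ ?_ (Precoverage.generate_mem_toGrothendieck hmem)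
  rw [Sieve.generate_le_iff]
  rintro Y _ ⟨i⟩
  fin_cases i
  · exact ⟨_, 𝟙 _, j, .mk WalkingPair.left, Category.id_comp _⟩
  · exact ⟨_, 𝟙 _, q, .mk WalkingPair.right, Category.id_comp _⟩

theorem ofTwoArrows_mem_nisnevichTopology_of_squares (Q : Square (SmAff S))
    (hQ : (affineNisnevichCD S).squares Q) :
    Sieve.ofTwoArrows Q.f₃₄ Q.f₂₄ ∈ nisnevichTopology S Q.X₄ := by
  obtain ⟨A, B, φ, f, hφ, hf, ⟨e⟩⟩ := hQ
  let e₂ : Q.X₂.obj.left ≅ Spec B := Square.evaluation₂.mapIso e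
  let e₃ : Q.X₃.obj.left ≅ Spec (.of (Localization.Away f)) := Square.evaluation₃.mapIso e
  let e₄ : Q.X₄.obj.left ≅ Spec A := Square.evaluation₄.mapIso e
  let l := Spec.map (CommRingCat.ofHom (algebraMap A (Localization.Away f)))
  let c := Spec.map (CommRingCat.ofHom (Ideal.Quotient.mk (Ideal.span {f})))
  have h₂₄ : Q.f₂₄.hom.left = e₂.hom ≫ Spec.map φ ≫ e₄.inv := by
    rw [← Category.assoc, Iso.eq_comp_inv]
    exact e.hom.comm₂₄
  have h₃₄ : Q.f₃₄.hom.left = e₃.hom ≫ l ≫ e₄.inv := by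
    rw [← Category.assoc, Iso.eq_comp_inv]
    exact e.hom.comm₃₄
  have : Etale Q.f₂₄.hom.left := by rw [h₂₄]; infer_instance
  have hl : IsOpenImmersion l := IsOpenImmersion.of_isLocalization f
  have : IsOpenImmersion Q.f₃₄.hom.left := by rw [h₃₄]; infer_instance
  have : IsClosedImmersion c :=
    IsClosedImmersion.spec_of_surjective _ Ideal.Quotient.mk_surjective
  have : LocallyOfFinitePresentation c := by
    refine HasRingHomProperty.Spec_iff.mpr ?_
    exact RingHom.finitePresentation_algebraMap.mpr
      (Algebra.FinitePresentation.quotient (Submodule.fg_span_singleton f))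
  obtain ⟨τ, hτ⟩ := hf.exists_hom
  obtain ⟨v, hv⟩ : ∃ v, v ≫ Sigma.desc (fun i => (pairHom Q.f₃₄ Q.f₂₄ i).hom.left) =
      Q.f₃₄.hom.left := ⟨Sigma.ι (fun i => (pairObj Q.X₃ Q.X₂ i).obj.left) 0,
        Sigma.ι_desc (fun i => (pairHom Q.f₃₄ Q.f₂₄ i).hom.left) 0⟩
  obtain ⟨w, hw⟩ : ∃ w, w ≫ Sigma.desc (fun i => (pairHom Q.f₃₄ Q.f₂₄ i).hom.left) =
      Q.f₂₄.hom.left := ⟨Sigma.ι (fun i => (pairObj Q.X₃ Q.X₂ i).obj.left) 1,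
        Sigma.ι_desc (fun i => (pairHom Q.f₃₄ Q.f₂₄ i).hom.left) 1⟩
  refine ofTwoArrows_mem_nisnevichTopology _ _
    (Scheme.hasSplittingSequence_of_closed_of_open (c ≫ e₄.inv) Q.f₃₄.hom.left ?_
      (Spec.map τ ≫ e₂.inv ≫ w) ?_ v hv)
  · intro x hx
    obtain ⟨y, hy⟩ : e₄.hom x ∈ Set.range l := by
      have h₁ : Set.range l = (PrimeSpectrum.basicOpen f : Set (PrimeSpectrum A)) :=
        PrimeSpectrum.localization_away_comap_range (Localization.Away f) f
      have h₂ : Set.range c = PrimeSpectrum.zeroLocus {f} := by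
        refine (range_comap_of_surjective _ _ Ideal.Quotient.mk_surjective).trans ?_
        rw [Ideal.mk_ker, PrimeSpectrum.zeroLocus_span]
      rw [h₁, PrimeSpectrum.basicOpen_eq_zeroLocus_compl, ← h₂]
      rintro ⟨y, hy⟩
      refine hx ⟨y, ?_⟩
      rw [Scheme.Hom.comp_apply, hy, ← Scheme.Hom.comp_apply, Iso.hom_inv_id]
      rfl
    refine ⟨e₃.inv y, ?_⟩
    rw [h₃₄, ← Scheme.Hom.comp_apply, Iso.inv_hom_id_assoc, Scheme.Hom.comp_apply, hy,
      ← Scheme.Hom.comp_apply, Iso.hom_inv_id]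
    rfl
  · rw [Category.assoc, Category.assoc, hw, h₂₄, Iso.inv_hom_id_assoc, ← Category.assoc,
      ← Spec.map_comp, hτ]

theorem bot_mem_nisnevichTopology {X : SmAff S} (hX : IsInitial X) :
    (⊥ : Sieve X) ∈ nisnevichTopology S X := by
  have := X.isEmpty_of_isInitial hX
  have hmem : Presieve.ofArrows (fun i : Fin 0 => (i.elim0 : SmAff S)) (fun i => i.elim0) ∈
      nisnevichPrecoverage S X := by
    -- The empty family with a chain of length `0`: this needs `⊥ = ⊤` among ideal sheaves, which
    -- holds because `X` is empty.
    refine ⟨0, _, _, fun i => i.elim0, ⟨0, fun _ => ⊥, monotone_const, rfl, ?_, ?_,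
      fun k => k.elim0⟩, rfl⟩
    · rw [← Scheme.IdealSheafData.support_eq_bot_iff]
      ext x
      exact (this.false x).elim
    · intro k
      infer_instance
  refine GrothendieckTopology.superset_covering _ ?_ (Precoverage.generate_mem_toGrothendieck hmem)
  rintro Y _ ⟨_, _, _, ⟨i⟩, _⟩
  exact i.elim0

end SmAff

theorem proposition2p9 (S : Scheme.{u}) [CompactSpace S] [QuasiSeparatedSpace S] :
    (affineNisnevichCD S).topology = nisnevichTopology S := by
  refine le_antisymm ?_ ?_
  · exact CDStructure.topology_le _ _ (fun X hX => SmAff.bot_mem_nisnevichTopology hX)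
      SmAff.ofTwoArrows_mem_nisnevichTopology_of_squares
  · refine Precoverage.toGrothendieck_le_iff_le_toPrecoverage.mpr ?_
    rintro X _ ⟨m, U, p, hp, h, rfl⟩
    have (i : Fin m) : Etale (p i).hom.left := hp i
    exact SmAff.mem_affineNisnevich_of_hasSplittingSequence p h
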